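/- Let $n \ge 1$ and let the group $G = \mathbb{Z}_2^{n-1}$ act smoothly on a closed (i.e. compact, without boundary) connected smooth $n$-dimensional manifold $X$. For a point $x$ fixed by all of $G$, let $\alpha_{x,1},\dots,\alpha_{x,n} \in \mathrm{Hom}(\mathbb{Z}_2^{n-1},\mathbb{Z}_2)\cong \mathbb{Z}_2^{n-1}$ be the weights of the tangent representation of $G$ at $x$, i.e. $T_xX \cong V(\alpha_{x,1})\oplus\dots\oplus V(\alpha_{x,n})$, where $V(\alpha)$ is the one-dimensional real representation $t\cdot y = (-1)^{\alpha(t)}y$. Suppose that 1. the action is in general position: for every $x \in X^G$, any $n-1$ of the weights $\alpha_{x,1},\dots,\alpha_{x,n}$ are linearly independent over $\mathbb{Z}_2$; 2. for every subgroup $H \subseteq G$, every connected component of $X^H = \{x \in X : hx = x \text{ for all } h\in H\}$ contains a point of $X^G$. Then the orbit space $Q = X/G$ is a topological manifold of dimension $n$ (Hausdorff, second countable, and every point has an open neighbourhood homeomorphic to an open subset of $\mathbb{R}^n$). -/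

import Mathlib

open scoped Manifold ContDiff

/-- The `2`-torus of rank `k`, written additively. -/
abbrev TwoTorus (k : ℕ) : Type := Fin k → ZMod 2

/-- The real number `1` or `-1` by which a class modulo two acts on `ℝ`. -/
noncomputable def sgn (a : ZMod 2) : ℝ := (-1) ^ a.val

/-- The homomorphisms `α 0, …, α (n - 1)` from the `2`-torus to `ZMod 2` are the weights of the
tangent representation at the fixed point `x`: the tangent space at `x` has a basis of vectors
`b i` such that the differential at `x` of the action of each `t` sends `b i` to `± b i`, with the
sign given by `α i t`, so that it is the direct sum of the one-dimensional representations
`V (α i)`. The equation is read in the tangent bundle, since the differential at `x` has values in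
the tangent space at `t +ᵥ x`. -/
def IsTangentWeights {n k : ℕ} {X : Type*} [TopologicalSpace X]
    [ChartedSpace (EuclideanSpace ℝ (Fin n)) X] [AddAction (TwoTorus k) X]
    (x : X) (α : Fin n → Module.Dual (ZMod 2) (TwoTorus k)) : Prop :=
  ∃ b : Module.Basis (Fin n) ℝ (TangentSpace (𝓡 n) x), ∀ (t : TwoTorus k) (i : Fin n),
    tangentMap (𝓡 n) (𝓡 n) (fun y : X => t +ᵥ y) ⟨x, b i⟩ =
      (⟨x, sgn (α i t) • b i⟩ : TangentBundle (𝓡 n) X)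

/-- An action of a `2`-torus on an `n`-manifold is in general position if at every global fixed
point any `n - 1` of the `n` weights of the tangent representation are linearly independent.
For a smooth action weights exist at every fixed point and are unique up to their order. -/
def InGeneralPosition (n k : ℕ) (X : Type*) [TopologicalSpace X]
    [ChartedSpace (EuclideanSpace ℝ (Fin n)) X] [AddAction (TwoTorus k) X] : Prop :=
  ∀ x ∈ AddAction.fixedPoints (TwoTorus k) X,
    ∃ α : Fin n → Module.Dual (ZMod 2) (TwoTorus k), IsTangentWeights x α ∧
      ∀ j : Fin n, LinearIndependent (ZMod 2) (fun i : {i : Fin n // i ≠ j} => α i)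

/-- For every subgroup `H`, every connected component of `X^H` has a global fixed point. -/
def ComponentsHaveFixedPoints (k : ℕ) (X : Type*) [TopologicalSpace X]
    [AddAction (TwoTorus k) X] : Prop :=
  ∀ (H : AddSubgroup (TwoTorus k)), ∀ x ∈ AddAction.fixedPoints H X,
    ∃ y ∈ connectedComponentIn (AddAction.fixedPoints H X) x,
      y ∈ AddAction.fixedPoints (TwoTorus k) X

/-- A topological manifold of dimension `n`, without boundary. -/
def IsTopologicalManifold (n : ℕ) (Q : Type*) [TopologicalSpace Q] : Prop :=
  T2Space Q ∧ SecondCountableTopology Q ∧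
    Nonempty (ChartedSpace (EuclideanSpace ℝ (Fin n)) Q)

/-! Near `x` the orbit space is the tangent space modulo the stabilizer `H`, so it suffices to
identify the action of `H` and its quotient. At a global fixed point the `n` weights satisfy the
single relation that their sum is zero, so the torus acts there by exactly the even changes of sign
of the coordinates (`exists_weights_apply_eq`). Choose such a point `y` in the component of `X^H`
through `x`, and let `J` be the set of weights at `y` that are nontrivial on `H`. The group `K =
signClosure H α` of all even changes of sign within `J` contains `H` and acts trivially on the
tangent space of the component at `y`. A connectedness argument carries both facts along the
component: `K` fixes `x`, so `K = H`, and acts at `x` as at `y`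
(`isotropyDiagonal_of_mem_connectedComponentIn`). The even changes of sign within `J` have quotient
`ℝ^n` again (`exists_fold`): the differences of the absolute values fix them up to a common shift,
the absolute value of the product fixes the shift, and its sign records the parity. -/

/-! ### Linearization of smooth finite group actions at fixed points -/

section Linearization

variable {E : Type*} [NormedAddCommGroup E] [NormedSpace ℝ E]
  {X : Type*} [TopologicalSpace X] [ChartedSpace E X]

theorem exists_hasMFDerivAt_extChartAt [IsManifold 𝓘(ℝ, E) 1 X] {x z : X}
    (hz : z ∈ (chartAt E x).source) :
    ∃ A : E ≃L[ℝ] E,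
      HasMFDerivAt 𝓘(ℝ, E) 𝓘(ℝ, E) (extChartAt 𝓘(ℝ, E) x) z (A : E →L[ℝ] E) := by
  have hinv : (mfderiv 𝓘(ℝ, E) 𝓘(ℝ, E) (extChartAt 𝓘(ℝ, E) x) z).IsInvertible :=
    isInvertible_mfderiv_extChartAt (by simpa [extChartAt] using hz)
  obtain ⟨A, hA⟩ := hinv
  have := (mdifferentiableAt_extChartAt (I := 𝓘(ℝ, E)) hz).hasMFDerivAt
  rw [← hA] at this
  exact ⟨A, this⟩

/-- The inverse function theorem for a map from a manifold to its model space: a smooth map with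
invertible differential at `x` is near `x` a homeomorphism with invertible differentials. -/
theorem exists_openPartialHomeomorph_of_hasMFDerivAt [CompleteSpace E] [IsManifold 𝓘(ℝ, E) ∞ X]
    {f : X → E} {x : X}
    (hf : ContMDiffAt 𝓘(ℝ, E) 𝓘(ℝ, E) ∞ f x) (B : E ≃L[ℝ] E)
    (hB : HasMFDerivAt 𝓘(ℝ, E) 𝓘(ℝ, E) f x (B : E →L[ℝ] E)) :
    ∃ ψ : OpenPartialHomeomorph X E, x ∈ ψ.source ∧ Set.EqOn ψ f ψ.source ∧
      ∀ z ∈ ψ.source, ∃ C : E ≃L[ℝ] E,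
        HasMFDerivAt 𝓘(ℝ, E) 𝓘(ℝ, E) f z (C : E →L[ℝ] E) := by
  have : IsManifold 𝓘(ℝ, E) 1 X := IsManifold.of_le (n := ∞) (by simp)
  set φ := chartAt E x with hφ
  set g : E → E := f ∘ φ.symm with hg
  have hgs : ContDiffAt ℝ ∞ g (φ x) := by
    have := (contMDiffAt_iff_source.1 hf)
    simp only [modelWithCornersSelf_coe, Set.range_id, contMDiffWithinAt_univ] at this
    simpa [extChartAt, hg, hφ] using this.contDiffAt
  have hgB : HasFDerivAt g (B : E →L[ℝ] E) (φ x) := by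
    have := hB.2
    simp only [modelWithCornersSelf_coe, Set.range_id] at this
    exact hasFDerivWithinAt_univ.1 this
  -- Invertible operators form an open set and the derivative is continuous, so invertibility
  -- persists near `φ x`.
  have hev : ∀ᶠ e in nhds (φ x), ∃ C : E ≃L[ℝ] E, HasFDerivAt g (C : E →L[ℝ] E) e := by
    have h1 : ∀ᶠ e in nhds (φ x), ContDiffAt ℝ 1 g e :=
      (hgs.of_le (m := 1) (by simp)).eventually (by simp)
    have h2 : ContinuousAt (fderiv ℝ g) (φ x) :=
      (hgs.fderiv_right (m := 0) (by simp)).continuousAt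
    have h3 : ∀ᶠ e in nhds (φ x), fderiv ℝ g e ∈
        Set.range (ContinuousLinearEquiv.toContinuousLinearMap : (E ≃L[ℝ] E) → E →L[ℝ] E) :=
      h2.eventually_mem (ContinuousLinearEquiv.isOpen.mem_nhds ⟨B, hgB.fderiv.symm⟩)
    filter_upwards [h1, h3] with e he1 ⟨C, hC⟩
    exact ⟨C, hC ▸ (he1.differentiableAt (by simp)).hasFDerivAt⟩
  obtain ⟨O, hO, hOo, hxO⟩ := eventually_nhds_iff.1 hev
  set χ := hgs.toOpenPartialHomeomorph g hgB (by simp) with hχ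
  refine ⟨φ.trans (χ.restrOpen O hOo), ?_, ?_, ?_⟩
  · simp only [OpenPartialHomeomorph.trans_source, Set.mem_inter_iff, Set.mem_preimage,
      OpenPartialHomeomorph.restrOpen_source]
    exact ⟨mem_chart_source E x, hgs.mem_toOpenPartialHomeomorph_source hgB (by simp), hxO⟩
  · intro z hz
    have hz1 : z ∈ φ.source := hz.1
    change g (φ z) = f z
    simp [hg, φ.left_inv hz1]
  · intro z hz
    have hz1 : z ∈ φ.source := hz.1
    have hz2 : φ z ∈ O := by
      have := hz.2
      simp only [Set.mem_preimage, OpenPartialHomeomorph.restrOpen_source] at this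
      exact this.2
    obtain ⟨C, hC⟩ := hO _ hz2
    obtain ⟨A, hA⟩ := exists_hasMFDerivAt_extChartAt (x := x) hz1
    have hcomp := HasMFDerivAt.comp z
      (g := g) (g' := (C : E →L[ℝ] E)) (by simpa [extChartAt] using hC.hasMFDerivAt) hA
    refine ⟨ContinuousLinearEquiv.trans A C, hcomp.congr_of_eventuallyEq ?_⟩
    filter_upwards [φ.open_source.mem_nhds hz1] with w hw
    simp [hg, extChartAt, ← hφ, φ.left_inv hw]

variable {G : Type} [AddGroup G] [AddAction G X]

/-- The differential of the action of `g` at `x`, in coordinates. It is the isotropy action on the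
tangent space when `g` fixes `x`. -/
noncomputable def isotropy (g : G) (x : X) : E →L[ℝ] E :=
  mfderiv 𝓘(ℝ, E) 𝓘(ℝ, E) (fun y : X => g +ᵥ y) x

theorem hasMFDerivAt_isotropy
    (hs : ∀ g : G, ContMDiff 𝓘(ℝ, E) 𝓘(ℝ, E) ∞ (fun y : X => g +ᵥ y)) (g : G) (x : X) :
    HasMFDerivAt 𝓘(ℝ, E) 𝓘(ℝ, E) (fun y : X => g +ᵥ y) x (isotropy (E := E) g x) :=
  ((hs g).mdifferentiable (by simp) x).hasMFDerivAt

theorem isotropy_zero (x : X) :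
    isotropy (E := E) (0 : G) x = ContinuousLinearMap.id ℝ E := by
  have : (fun y : X => (0 : G) +ᵥ y) = id := funext fun y => zero_vadd G y
  unfold isotropy
  rw [this]
  exact mfderiv_id

theorem isotropy_add
    (hs : ∀ g : G, ContMDiff 𝓘(ℝ, E) 𝓘(ℝ, E) ∞ (fun y : X => g +ᵥ y)) (g h : G) (x : X) :
    isotropy (E := E) (g + h) x = (isotropy (E := E) g (h +ᵥ x)).comp (isotropy (E := E) h x) := by
  have h1 := HasMFDerivAt.comp x (hasMFDerivAt_isotropy hs g (h +ᵥ x))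
    (hasMFDerivAt_isotropy hs h x)
  have h2 : ((fun y : X => g +ᵥ y) ∘ fun y : X => h +ᵥ y) = fun y : X => (g + h) +ᵥ y :=
    funext fun y => (add_vadd g h y).symm
  rw [h2] at h1
  exact h1.mfderiv

/-- Bochner's linearization theorem: near a fixed point a smooth action of a finite group is
conjugate to its tangent representation. -/
theorem exists_linearization [CompleteSpace E] [IsManifold 𝓘(ℝ, E) ∞ X] [Finite G]
    (hs : ∀ g : G, ContMDiff 𝓘(ℝ, E) 𝓘(ℝ, E) ∞ (fun y : X => g +ᵥ y)) (x : X)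
    (hx : ∀ g : G, g +ᵥ x = x) :
    ∃ ψ : OpenPartialHomeomorph X E, x ∈ ψ.source ∧
      (∀ g : G, ∀ z ∈ ψ.source, g +ᵥ z ∈ ψ.source ∧ ψ (g +ᵥ z) = isotropy (E := E) g x (ψ z)) ∧
      ∀ z ∈ ψ.source, ∃ C : E ≃L[ℝ] E,
        HasMFDerivAt 𝓘(ℝ, E) 𝓘(ℝ, E) ψ z (C : E →L[ℝ] E) := by
  classical
  have := Fintype.ofFinite G
  have : IsManifold 𝓘(ℝ, E) 1 X := IsManifold.of_le (n := ∞) (by simp)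
  obtain ⟨A, hφd⟩ := exists_hasMFDerivAt_extChartAt (mem_chart_source E x)
  set R : G → E →L[ℝ] E := fun g => isotropy (E := E) g x with hR
  have hRadd : ∀ g h, R (g + h) = (R g).comp (R h) := by
    intro g h
    have := isotropy_add hs g h x
    rwa [hx h] at this
  set φ : X → E := ⇑(extChartAt 𝓘(ℝ, E) x) with hφ
  have hφs : ContMDiffAt 𝓘(ℝ, E) 𝓘(ℝ, E) ∞ φ x := contMDiffAt_extChartAt
  -- Averaging the chart over the group makes it equivariant. The twist by `R (-g)` and `A.symm`
  -- gives each summand the identity as differential at `x`, so the undivided sum has differential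
  -- multiplication by the order of `G`.
  set T : G → E →L[ℝ] E := fun g => (R (-g)).comp (A.symm : E →L[ℝ] E) with hT
  set Ψ : X → E := fun z => ∑ g : G, T g (φ (g +ᵥ z)) with hΨ
  have hequiv : ∀ k z, Ψ (k +ᵥ z) = R k (Ψ z) := by
    intro k z
    simp only [hΨ, map_sum]
    rw [← Equiv.sum_comp (Equiv.addRight (-k))]
    refine Finset.sum_congr rfl fun g _ => ?_
    simp only [Equiv.coe_addRight, hT, neg_add_rev, neg_neg, hRadd, ContinuousLinearMap.comp_apply]
    rw [vadd_vadd]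
    simp
  have hterm : ∀ g : G, HasMFDerivAt 𝓘(ℝ, E) 𝓘(ℝ, E) (fun z : X => T g (φ (g +ᵥ z))) x
      (ContinuousLinearMap.id ℝ E) := by
    intro g
    have h1 : HasMFDerivAt 𝓘(ℝ, E) 𝓘(ℝ, E) φ (g +ᵥ x) (A : E →L[ℝ] E) := by
      rw [hx g]; exact hφd
    have h2 := HasMFDerivAt.comp x h1 (hasMFDerivAt_isotropy hs g x)
    have h3 := HasMFDerivAt.comp x ((T g).hasMFDerivAt) h2
    refine HasMFDerivAt.congr_mfderiv h3 ?_
    have h4 : (R (-g)).comp (R g) = ContinuousLinearMap.id ℝ E := by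
      rw [← hRadd, neg_add_cancel]; exact isotropy_zero x
    ext v
    change R (-g) (A.symm (A (R g v))) = v
    rw [A.symm_apply_apply]
    exact congrArg (fun f : E →L[ℝ] E => f v) h4
  have hsmooth : ContMDiffAt 𝓘(ℝ, E) 𝓘(ℝ, E) ∞ Ψ x := by
    refine ContMDiffAt.sum fun g _ => ?_
    refine (T g).contDiff.contMDiff.contMDiffAt.comp x ?_
    refine ContMDiffAt.comp x ?_ (hs g x)
    rw [hx g]; exact hφs
  have hcard : ((Fintype.card G : ℝ)) ≠ 0 := Nat.cast_ne_zero.2 Fintype.card_ne_zero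
  have hder : HasMFDerivAt 𝓘(ℝ, E) 𝓘(ℝ, E) Ψ x
      ((ContinuousLinearEquiv.smulLeft (Units.mk0 _ hcard) : E ≃L[ℝ] E) : E →L[ℝ] E) := by
    have h1 : HasMFDerivAt 𝓘(ℝ, E) 𝓘(ℝ, E) Ψ x (∑ g : G, ContinuousLinearMap.id ℝ E) :=
      (HasMFDerivAt.sum (t := Finset.univ) fun g _ => hterm g).congr_of_eventuallyEq
        (Filter.Eventually.of_forall fun z => by simp [hΨ])
    refine HasMFDerivAt.congr_mfderiv h1 ?_
    refine ContinuousLinearMap.ext fun v : E => ?_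
    change (∑ g : G, ContinuousLinearMap.id ℝ E) v = (Fintype.card G : ℝ) • v
    simp [Nat.cast_smul_eq_nsmul]
  obtain ⟨ψ, hxψ, heq, hC⟩ := exists_openPartialHomeomorph_of_hasMFDerivAt hsmooth _ hder
  have hcont : ∀ g : G, Continuous (fun y : X => g +ᵥ y) := fun g => (hs g).continuous
  -- The largest invariant subset of the source.
  set S : Set X := ⋂ g : G, (fun y : X => g +ᵥ y) ⁻¹' ψ.source with hS
  have hSo : IsOpen S := isOpen_iInter_of_finite fun g => ψ.open_source.preimage (hcont g)
  have hSψ : S ⊆ ψ.source := fun z hz => by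
    have := Set.mem_iInter.1 hz 0
    simpa using this
  have hsrc : (ψ.restrOpen S hSo).source = S := by
    rw [OpenPartialHomeomorph.restrOpen_source, Set.inter_eq_right.2 hSψ]
  have hSinv : ∀ g : G, ∀ z ∈ S, g +ᵥ z ∈ S := by
    intro g z hz
    refine Set.mem_iInter.2 fun h => ?_
    have := Set.mem_iInter.1 hz (h + g)
    simpa [add_vadd] using this
  refine ⟨ψ.restrOpen S hSo, ?_, ?_, ?_⟩
  · rw [hsrc]
    refine Set.mem_iInter.2 fun g => ?_
    simpa [hx g] using hxψ
  · rw [hsrc]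
    refine fun g z hz => ⟨hSinv g z hz, ?_⟩
    change ψ (g +ᵥ z) = R g (ψ z)
    rw [heq (hSψ (hSinv g z hz)), heq (hSψ hz), hequiv]
  · rw [hsrc]
    intro z hz
    obtain ⟨C, hC⟩ := hC z (hSψ hz)
    refine ⟨C, hC.congr_of_eventuallyEq ?_⟩
    filter_upwards [ψ.open_source.mem_nhds (hSψ hz)] with w hw
    exact heq hw

end Linearization

/-! ### The quotient of Euclidean space by even changes of sign -/

section Fold

variable {ι : Type*} [Fintype ι] [DecidableEq ι]

theorem eq_zero_or_eq_one_of_zmod_two : ∀ a : ZMod 2, a = 0 ∨ a = 1 := by decide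

theorem abs_sgn (a : ZMod 2) : |sgn a| = 1 := by
  simp [sgn, abs_pow]

theorem sgn_zero : sgn 0 = 1 := by simp [sgn]

theorem sgn_one : sgn 1 = -1 := by simp [sgn, ZMod.val_one]

theorem sgn_add (a b : ZMod 2) : sgn (a + b) = sgn a * sgn b := by
  rcases eq_zero_or_eq_one_of_zmod_two a with rfl | rfl <;>
    rcases eq_zero_or_eq_one_of_zmod_two b with rfl | rfl <;>
    simp [sgn_zero, sgn_one, CharTwo.add_self_eq_zero]

omit [Fintype ι] in
theorem sgn_sum (s : Finset ι) (ε : ι → ZMod 2) : sgn (∑ i ∈ s, ε i) = ∏ i ∈ s, sgn (ε i) := by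
  induction s using Finset.induction_on with
  | empty => simp [sgn_zero]
  | insert a s ha ih => rw [Finset.sum_insert ha, Finset.prod_insert ha, sgn_add, ih]

theorem sgn_eq_one_iff (a : ZMod 2) : sgn a = 1 ↔ a = 0 := by
  rcases eq_zero_or_eq_one_of_zmod_two a with rfl | rfl
  · simp [sgn_zero]
  · norm_num [sgn_one]

theorem exists_eq_sgn_mul {a b : ℝ} (h : |a| = |b|) : ∃ e : ZMod 2, b = sgn e * a := by
  rcases abs_eq_abs.1 h with h | h
  · exact ⟨0, by rw [sgn_zero, one_mul, h]⟩
  · exact ⟨1, by rw [sgn_one, h]; ring⟩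

omit [Fintype ι] [DecidableEq ι] in
theorem one_le_prod_of_one_le {s : Finset ι} {f : ι → ℝ} (hf : ∀ i ∈ s, 1 ≤ f i) :
    1 ≤ ∏ i ∈ s, f i := by
  simpa using Finset.prod_le_prod (f := fun _ : ι => (1 : ℝ)) (fun _ _ => zero_le_one) hf

omit [Fintype ι] [DecidableEq ι] in
theorem prod_lt_prod_of_nonneg {s : Finset ι} (hs : s.Nonempty) {f g : ι → ℝ}
    (hf : ∀ i ∈ s, 0 ≤ f i) (hfg : ∀ i ∈ s, f i < g i) : ∏ i ∈ s, f i < ∏ i ∈ s, g i := by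
  by_cases h : ∃ i ∈ s, f i = 0
  · obtain ⟨i, hi, hi0⟩ := h
    rw [Finset.prod_eq_zero hi hi0]
    exact Finset.prod_pos fun j hj => (hf j hj).trans_lt (hfg j hj)
  · push Not at h
    exact Finset.prod_lt_prod_of_nonempty
      (fun i hi => lt_of_le_of_ne (hf i hi) (h i hi).symm) hfg hs

/-- The map `ℝ ^ ι → ℝ ^ ι` that forgets a vector up to an even number of changes of sign of its
coordinates in `J`. -/
noncomputable def fold (J : Finset ι) (j : ι) (v : ι → ℝ) : ι → ℝ := fun i =>
  if i ∈ J then (if i = j then ∏ l ∈ J, v l else |v i| - |v j|) else v i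

omit [Fintype ι] in
theorem continuous_fold (J : Finset ι) (j : ι) : Continuous (fold J j) := by
  refine continuous_pi fun i => ?_
  unfold fold
  split_ifs <;> fun_prop

/-- This makes `fold` proper. The absolute values in `J` differ from `|v j|` by at most `M`; if `|v
j|` exceeded `M + 1`, they would all be at least `1`, and the product, at least `|v j|`, would
exceed `M`. -/
theorem norm_le_of_fold (J : Finset ι) {j : ι} (hj : j ∈ J) (v : ι → ℝ) :
    ‖v‖ ≤ 2 * ‖fold J j v‖ + 1 := by
  set M := ‖fold J j v‖ with hM
  have hM0 : 0 ≤ M := norm_nonneg _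
  have hco : ∀ i, |fold J j v i| ≤ M := fun i => norm_le_pi_norm (fold J j v) i
  have hdiff : ∀ i ∈ J, |(|v i| - |v j|)| ≤ M := by
    intro i hi
    by_cases hij : i = j
    · simpa [hij] using hM0
    · simpa [fold, hi, hij] using hco i
  have hprod : ∏ l ∈ J, |v l| ≤ M := by
    rw [← Finset.abs_prod]
    simpa [fold, hj] using hco j
  have hvj : |v j| ≤ M + 1 := by
    by_contra! hlt
    have hone : ∀ i ∈ J, 1 ≤ |v i| := fun i hi => by
      have := (abs_le.1 (hdiff i hi)).1
      linarith
    have : |v j| ≤ ∏ l ∈ J, |v l| := by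
      rw [← Finset.mul_prod_erase J _ hj]
      refine le_mul_of_one_le_right (abs_nonneg _) ?_
      exact one_le_prod_of_one_le fun i hi => hone i (Finset.mem_of_mem_erase hi)
    linarith
  refine (pi_norm_le_iff_of_nonneg (by linarith)).2 fun i => ?_
  rw [Real.norm_eq_abs]
  by_cases hi : i ∈ J
  · have := (abs_le.1 (hdiff i hi)).2
    linarith
  · have := hco i
    simp only [fold, hi, if_false] at this
    linarith

theorem isClosedMap_fold (J : Finset ι) {j : ι} (hj : j ∈ J) : IsClosedMap (fold J j) := by
  refine (isProperMap_iff_isCompact_preimage.2 ⟨continuous_fold J j, fun K hK => ?_⟩).isClosedMap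
  refine Metric.isCompact_of_isClosed_isBounded (hK.isClosed.preimage (continuous_fold J j)) ?_
  obtain ⟨C, hC⟩ := hK.isBounded.exists_norm_le
  refine isBounded_iff_forall_norm_le.2 ⟨2 * C + 1, fun v hv => ?_⟩
  have := norm_le_of_fold J hj v
  have := hC _ hv
  linarith

-- The unknown is `s = |v j|`, with `|v i| = d i + s`. The product of the `d i + s` vanishes at the
-- least admissible `s` and later exceeds `|w j|`, so the intermediate value theorem applies. The
-- sign of `w j` is then given to coordinate `j`.
omit [Fintype ι] in
theorem fold_surjective (J : Finset ι) {j : ι} (hj : j ∈ J) : Function.Surjective (fold J j) := by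
  intro w
  set d : ι → ℝ := fun i => if i = j then 0 else w i with hd
  obtain ⟨i₀, hi₀, hmin⟩ := Finset.exists_min_image J d ⟨j, hj⟩
  have hle : -d i₀ ≤ -d i₀ + 1 + |w j| := by have := abs_nonneg (w j); linarith
  have hcont : ContinuousOn (fun s : ℝ => ∏ i ∈ J, (d i + s)) (Set.Icc (-d i₀) (-d i₀ + 1 + |w j|)) :=
    by fun_prop
  have hmem : |w j| ∈ Set.Icc (∏ i ∈ J, (d i + -d i₀)) (∏ i ∈ J, (d i + (-d i₀ + 1 + |w j|))) := by
    constructor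
    · rw [Finset.prod_eq_zero hi₀ (by ring)]
      exact abs_nonneg _
    · have h1 : ∀ i ∈ J, 1 + |w j| ≤ d i + (-d i₀ + 1 + |w j|) := fun i hi => by
        have := hmin i hi; linarith
      rw [← Finset.mul_prod_erase J _ hj]
      have h2 : 1 ≤ ∏ i ∈ J.erase j, (d i + (-d i₀ + 1 + |w j|)) :=
        one_le_prod_of_one_le fun i hi => by
          have := h1 i (Finset.mem_of_mem_erase hi)
          have := abs_nonneg (w j)
          linarith
      have h3 := h1 j hj
      have h4 := abs_nonneg (w j)
      nlinarith
  obtain ⟨s, hs, hprod⟩ := intermediate_value_Icc hle hcont hmem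
  have hnn : ∀ i ∈ J, 0 ≤ d i + s := fun i hi => by
    have := hmin i hi; have := hs.1; linarith
  have hdj : d j = 0 := by simp [hd]
  obtain ⟨e, he⟩ := exists_eq_sgn_mul (abs_abs (w j))
  refine ⟨fun i => if i ∈ J then (if i = j then sgn e * s else d i + s) else w i, ?_⟩
  funext i
  by_cases hi : i ∈ J
  · by_cases hij : i = j
    · subst hij
      simp only [fold, hi, if_true]
      rw [he, ← hprod]
      simp only
      rw [← Finset.mul_prod_erase J _ hi, ← Finset.mul_prod_erase J (fun i => d i + s) hi]
      simp only [hi, if_true, hdj, zero_add]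
      rw [mul_assoc]
      congr 2
      refine Finset.prod_congr rfl fun l hl => ?_
      rw [if_pos (Finset.mem_of_mem_erase hl), if_neg (Finset.ne_of_mem_erase hl)]
    · have h1 := hnn i hi
      have h2 := hnn j hj
      rw [hdj, zero_add] at h2
      simp only [fold, hi, hj, hij, if_true, if_false]
      rw [abs_mul, abs_sgn, one_mul, abs_of_nonneg h1, abs_of_nonneg h2]
      simp [hd, hij]
  · simp [fold, hi]

/-- The fibres of `fold` are the orbits of the group of even changes of sign. -/
theorem fold_eq_fold_iff (J : Finset ι) {j : ι} (hj : j ∈ J) (v w : ι → ℝ) :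
    fold J j v = fold J j w ↔
      ∃ ε : ι → ZMod 2, (∀ i ∉ J, ε i = 0) ∧ ∑ i, ε i = 0 ∧ ∀ i, w i = sgn (ε i) * v i := by
  have hsumJ : ∀ ε : ι → ZMod 2, (∀ i ∉ J, ε i = 0) → ∑ i, ε i = ∑ i ∈ J, ε i := fun ε hε =>
    (Finset.sum_subset (Finset.subset_univ J) fun i _ hi => hε i hi).symm
  constructor
  · intro h
    have hout : ∀ i ∉ J, w i = v i := fun i hi => by
      have := congrFun h i
      simpa [fold, hi] using this.symm
    have hprod : ∏ l ∈ J, v l = ∏ l ∈ J, w l := by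
      have := congrFun h j
      simpa [fold, hj] using this
    have hdiff : ∀ i ∈ J, |v i| - |v j| = |w i| - |w j| := fun i hi => by
      by_cases hij : i = j
      · simp [hij]
      · have := congrFun h i
        simpa [fold, hi, hij] using this
    have habsprod : ∏ l ∈ J, |v l| = ∏ l ∈ J, |w l| := by
      rw [← Finset.abs_prod, ← Finset.abs_prod, hprod]
    -- A strict inequality at `j` would, by the equal differences, hold throughout `J` and make the
    -- products of absolute values differ.
    have habsj : |v j| = |w j| := by
      rcases lt_trichotomy |v j| |w j| with hlt | heq | hlt
      · refine absurd habsprod (prod_lt_prod_of_nonneg ⟨j, hj⟩ (fun i _ => abs_nonneg _) ?_).ne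
        intro i hi
        have := hdiff i hi
        linarith
      · exact heq
      · refine absurd habsprod (prod_lt_prod_of_nonneg ⟨j, hj⟩ (fun i _ => abs_nonneg _) ?_).ne'
        intro i hi
        have := hdiff i hi
        linarith
    have habs : ∀ i ∈ J, |v i| = |w i| := fun i hi => by
      have := hdiff i hi
      linarith
    have hex : ∀ i, ∃ e : ZMod 2, (i ∉ J → e = 0) ∧ w i = sgn e * v i := fun i => by
      by_cases hi : i ∈ J
      · obtain ⟨e, he⟩ := exists_eq_sgn_mul (habs i hi)
        exact ⟨e, fun h => absurd hi h, he⟩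
      · exact ⟨0, fun _ => rfl, by rw [sgn_zero, one_mul, hout i hi]⟩
    choose ε hε0 hε using hex
    by_cases hz : ∃ l ∈ J, v l = 0
    · obtain ⟨l, hl, hl0⟩ := hz
      -- The sign at a vanishing coordinate is free, so it can absorb the parity.
      refine ⟨Function.update ε l (ε l - ∑ i, ε i), ?_, ?_, ?_⟩
      · intro i hi
        rw [Function.update_of_ne (by rintro rfl; exact hi hl)]
        exact hε0 i hi
      · rw [← Finset.add_sum_erase _ _ (Finset.mem_univ l), Function.update_self,
          Finset.sum_congr rfl fun i hi => Function.update_of_ne (Finset.ne_of_mem_erase hi) _ _,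
          ← Finset.add_sum_erase _ ε (Finset.mem_univ l)]
        ring
      · intro i
        by_cases hil : i = l
        · subst hil
          have := hε i
          rw [hl0, mul_zero] at this
          rw [this, hl0, mul_zero]
        · rw [Function.update_of_ne hil]
          exact hε i
    · push Not at hz
      refine ⟨ε, hε0, ?_, hε⟩
      rw [hsumJ ε hε0, ← sgn_eq_one_iff, sgn_sum]
      have h1 : ∏ l ∈ J, w l = (∏ l ∈ J, sgn (ε l)) * ∏ l ∈ J, v l := by
        rw [← Finset.prod_mul_distrib]
        exact Finset.prod_congr rfl fun i _ => hε i
      rw [← hprod] at h1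
      exact (mul_eq_right₀ (Finset.prod_ne_zero_iff.2 hz)).1 h1.symm
  · rintro ⟨ε, hε0, hsum, hε⟩
    have habs : ∀ i, |w i| = |v i| := fun i => by rw [hε, abs_mul, abs_sgn, one_mul]
    funext i
    unfold fold
    split_ifs with h1 h2
    · rw [Finset.prod_congr rfl fun i _ => hε i, Finset.prod_mul_distrib, ← sgn_sum,
        ← hsumJ ε hε0, hsum, sgn_zero, one_mul]
    · rw [habs, habs]
    · rw [hε, hε0 i h1, sgn_zero, one_mul]

/-- A closed continuous surjection is a quotient map, and the saturation of an open set is a union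
of its preimages under sign changes. -/
theorem isOpenMap_fold (J : Finset ι) {j : ι} (hj : j ∈ J) : IsOpenMap (fold J j) := by
  have hq : Topology.IsQuotientMap (fold J j) :=
    (isClosedMap_fold J hj).isQuotientMap (continuous_fold J j) (fold_surjective J hj)
  intro U hU
  rw [← hq.isOpen_preimage]
  have : fold J j ⁻¹' (fold J j '' U) =
      ⋃ ε ∈ {ε : ι → ZMod 2 | (∀ i ∉ J, ε i = 0) ∧ ∑ i, ε i = 0},
        (fun v : ι → ℝ => fun i => sgn (ε i) * v i) ⁻¹' U := by
    ext v
    simp only [Set.mem_preimage, Set.mem_image, Set.mem_iUnion, Set.mem_ofPred_eq, exists_prop]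
    constructor
    · rintro ⟨u, hu, huv⟩
      obtain ⟨ε, h0, hs, hε⟩ := (fold_eq_fold_iff J hj v u).1 huv.symm
      refine ⟨ε, ⟨h0, hs⟩, ?_⟩
      rwa [← funext hε]
    · rintro ⟨ε, ⟨h0, hs⟩, hu⟩
      exact ⟨_, hu, ((fold_eq_fold_iff J hj v _).2 ⟨ε, h0, hs, fun _ => rfl⟩).symm⟩
  rw [this]
  exact isOpen_biUnion fun ε _ => hU.preimage (by fun_prop)

/-- The quotient of `ℝ ^ ι` by the even changes of sign of the coordinates in `J` is `ℝ ^ ι`. -/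
theorem exists_fold (J : Finset ι) :
    ∃ f : (ι → ℝ) → (ι → ℝ), Continuous f ∧ IsOpenMap f ∧ ∀ v w, f v = f w ↔
      ∃ ε : ι → ZMod 2, (∀ i ∉ J, ε i = 0) ∧ ∑ i, ε i = 0 ∧ ∀ i, w i = sgn (ε i) * v i := by
  rcases J.eq_empty_or_nonempty with rfl | ⟨j, hj⟩
  · refine ⟨id, continuous_id, IsOpenMap.id, fun v w => ⟨?_, ?_⟩⟩
    · rintro rfl
      exact ⟨0, by simp, by simp, by simp [sgn_zero]⟩
    · rintro ⟨ε, h0, -, hε⟩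
      funext i
      simp [hε i, h0 i (by simp), sgn_zero]
  · exact ⟨fold J j, continuous_fold J j, isOpenMap_fold J hj, fold_eq_fold_iff J hj⟩

end Fold

/-! ### Weights in general position -/

section Weights

variable {n : ℕ} {α : Fin n → Module.Dual (ZMod 2) (TwoTorus (n - 1))}

/-- If any `n - 1` of `n` functionals on a space of dimension `n - 1` over the field with two
elements are linearly independent, then their sum is zero. -/
theorem sum_weights_eq_zero (hn : 1 ≤ n)
    (hα : ∀ j : Fin n, LinearIndependent (ZMod 2) (fun i : {i : Fin n // i ≠ j} => α i)) :
    ∑ i, α i = 0 := by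
  have hdep : ¬ LinearIndependent (ZMod 2) α := by
    intro h
    have := h.fintype_card_le_finrank
    rw [Subspace.dual_finrank_eq, Module.finrank_fintype_fun_eq_card] at this
    simp only [Fintype.card_fin] at this
    omega
  obtain ⟨c, hc, j, hj⟩ := Fintype.not_linearIndependent_iff.1 hdep
  -- A vanishing coefficient would leave a nontrivial relation among `n - 1` of the weights.
  have hne : ∀ i, c i ≠ 0 := by
    intro i hi
    have h1 : ∑ l : {l : Fin n // l ≠ i}, c l • α l = 0 := by
      rw [← hc, ← Finset.add_sum_erase _ _ (Finset.mem_univ i), hi, zero_smul, zero_add]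
      symm
      exact Finset.sum_subtype _ (by simp) _
    have h2 := Fintype.linearIndependent_iff.1 (hα i) (fun l => c l) h1
    by_cases hij : j = i
    · exact hj (hij ▸ hi)
    · exact hj (h2 ⟨j, hij⟩)
  have hone : ∀ i, c i = 1 := fun i => (eq_zero_or_eq_one_of_zmod_two (c i)).resolve_left (hne i)
  simpa [hone] using hc

/-- The `2`-torus acts through weights in general position by all even changes of sign. -/
theorem exists_weights_apply_eq (hn : 1 ≤ n)
    (hα : ∀ j : Fin n, LinearIndependent (ZMod 2) (fun i : {i : Fin n // i ≠ j} => α i))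
    (ε : Fin n → ZMod 2) (hε : ∑ i, ε i = 0) :
    ∃ t : TwoTorus (n - 1), ∀ i, α i t = ε i := by
  -- The weights other than `j` form a basis of the dual, so their values can be prescribed; the
  -- value of the weight `j` is then forced, since the weights and `ε` both sum to zero.
  let j : Fin n := ⟨0, hn⟩
  let A : TwoTorus (n - 1) →ₗ[ZMod 2] ({i : Fin n // i ≠ j} → ZMod 2) :=
    LinearMap.pi fun i => α i
  have hcard : Module.finrank (ZMod 2) (TwoTorus (n - 1)) =
      Module.finrank (ZMod 2) ({i : Fin n // i ≠ j} → ZMod 2) := by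
    simp [Module.finrank_fintype_fun_eq_card, Fintype.card_subtype_compl]
  have hspan : Submodule.span (ZMod 2) (Set.range fun i : {i : Fin n // i ≠ j} => α i) = ⊤ := by
    refine (hα j).span_eq_top_of_card_eq_finrank' ?_
    rw [Subspace.dual_finrank_eq, hcard, Module.finrank_fintype_fun_eq_card]
  have hinj : Function.Injective A := by
    rw [← LinearMap.ker_eq_bot, LinearMap.ker_eq_bot']
    intro t ht
    refine (Module.forall_dual_apply_eq_zero_iff (ZMod 2) t).1 fun f => ?_
    have hf : f ∈ Submodule.span (ZMod 2) (Set.range fun i : {i : Fin n // i ≠ j} => α i) :=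
      hspan ▸ Submodule.mem_top
    induction hf using Submodule.span_induction with
    | mem f hf =>
      obtain ⟨i, rfl⟩ := hf
      exact congrFun ht i
    | zero => rfl
    | add f g _ _ hf hg => rw [LinearMap.add_apply, hf, hg, add_zero]
    | smul a f _ hf => rw [LinearMap.smul_apply, hf, smul_zero]
  obtain ⟨t, ht⟩ := (LinearMap.injective_iff_surjective_of_finrank_eq_finrank hcard).1 hinj
    (fun i => ε i)
  have hti : ∀ i, i ≠ j → α i t = ε i := fun i hi => congrFun ht ⟨i, hi⟩
  refine ⟨t, fun i => ?_⟩
  by_cases hi : i = j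
  · subst hi
    have h1 : ∑ i, α i t = 0 := by
      rw [← LinearMap.sum_apply, sum_weights_eq_zero hn hα, LinearMap.zero_apply]
    rw [← hε, ← Finset.add_sum_erase _ _ (Finset.mem_univ j),
      ← Finset.add_sum_erase _ ε (Finset.mem_univ j),
      Finset.sum_congr rfl fun i hi => hti i (Finset.ne_of_mem_erase hi)] at h1
    exact add_right_cancel h1
  · exact hti i hi

end Weights

/-! ### Constancy of the isotropy representation along components -/

section Propagation

variable {E : Type*} [NormedAddCommGroup E] [NormedSpace ℝ E]
  {X : Type*} [TopologicalSpace X] [ChartedSpace E X]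
  {G : Type} [AddGroup G] [AddAction G X]

/-- A smooth action of a finite group `K` is linear in suitable coordinates near a fixed point `x`,
and the isotropy representations at the fixed points near `x` are isomorphic to that at `x`. -/
theorem exists_linearization_addSubgroup [CompleteSpace E] [IsManifold 𝓘(ℝ, E) ∞ X] [Finite G]
    (hs : ∀ g : G, ContMDiff 𝓘(ℝ, E) 𝓘(ℝ, E) ∞ (fun y : X => g +ᵥ y)) (K : AddSubgroup G) (x : X)
    (hx : ∀ g ∈ K, g +ᵥ x = x) :
    ∃ ψ : OpenPartialHomeomorph X E, x ∈ ψ.source ∧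
      (∀ g ∈ K, ∀ z ∈ ψ.source, g +ᵥ z ∈ ψ.source ∧ ψ (g +ᵥ z) = isotropy (E := E) g x (ψ z)) ∧
      ∀ z ∈ ψ.source, (∀ g ∈ K, g +ᵥ z = z) → ∃ C : E ≃L[ℝ] E, ∀ g ∈ K, ∀ v,
        isotropy (E := E) g z (C v) = C (isotropy (E := E) g x v) := by
  obtain ⟨ψ, hxψ, hψ, hd⟩ := exists_linearization (G := K) (E := E) (fun g => hs g) x
    fun g => hx g g.2
  refine ⟨ψ, hxψ, fun g hg z hz => hψ ⟨g, hg⟩ z hz, fun z hz hfix => ?_⟩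
  obtain ⟨D, hD⟩ := hd z hz
  -- Differentiating the equivariance of `ψ` at `z` shows that `D` intertwines the two
  -- representations.
  refine ⟨D.symm, fun g hg v => ?_⟩
  have h1 : HasMFDerivAt 𝓘(ℝ, E) 𝓘(ℝ, E) (ψ ∘ fun y : X => g +ᵥ y) z
      ((D : E →L[ℝ] E).comp (isotropy (E := E) g z)) := by
    refine HasMFDerivAt.comp z ?_ (hasMFDerivAt_isotropy hs g z)
    rw [hfix g hg]
    exact hD
  have h2 : HasMFDerivAt 𝓘(ℝ, E) 𝓘(ℝ, E) (ψ ∘ fun y : X => g +ᵥ y) z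
      ((isotropy (E := E) g x).comp (D : E →L[ℝ] E)) := by
    refine (HasMFDerivAt.comp z (isotropy (E := E) g x).hasMFDerivAt hD).congr_of_eventuallyEq ?_
    filter_upwards [ψ.open_source.mem_nhds hz] with w hw
    exact (hψ ⟨g, hg⟩ w hw).2
  have h3 : (D : E →L[ℝ] E).comp (isotropy (E := E) g z) =
      (isotropy (E := E) g x).comp (D : E →L[ℝ] E) := hasMFDerivAt_unique h1 h2
  have h4 : D (isotropy (E := E) g z (D.symm v)) = isotropy (E := E) g x (D (D.symm v)) :=
    congrArg (fun f : E →L[ℝ] E => f (D.symm v)) h3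
  rw [D.apply_symm_apply] at h4
  rw [← h4, D.symm_apply_apply]

/-- The isotropy representation of `K` at `x` is diagonal in some basis, with the signs `α`. -/
def IsotropyDiagonal {ι : Type*} (K : AddSubgroup G) (α : ι → G → ZMod 2) (x : X) : Prop :=
  ∃ B : (ι → ℝ) ≃L[ℝ] E, ∀ g ∈ K, ∀ v,
    isotropy (E := E) g x (B v) = B fun i => sgn (α i g) * v i

theorem IsotropyDiagonal.congr {ι : Type*} {K : AddSubgroup G} {α : ι → G → ZMod 2} {x z : X}
    (h : IsotropyDiagonal (E := E) K α x) (C : E ≃L[ℝ] E)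
    (hC : ∀ g ∈ K, ∀ v, isotropy (E := E) g z (C v) = C (isotropy (E := E) g x v)) :
    IsotropyDiagonal (E := E) K α z := by
  obtain ⟨B, hB⟩ := h
  refine ⟨B.trans C, fun g hg v => ?_⟩
  rw [ContinuousLinearEquiv.trans_apply, hC g hg, hB g hg, ContinuousLinearEquiv.trans_apply]

/-- The elements on which every `α i` that vanishes on `H` vanishes. -/
def signClosure {ι : Type*} (H : AddSubgroup G) (α : ι → G →+ ZMod 2) : AddSubgroup G :=
  ⨅ i ∈ {i | ∀ h ∈ H, α i h = 0}, (α i).ker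

theorem mem_signClosure {ι : Type*} {H : AddSubgroup G} {α : ι → G →+ ZMod 2} {g : G} :
    g ∈ signClosure H α ↔ ∀ i, (∀ h ∈ H, α i h = 0) → α i g = 0 := by
  simp [signClosure, AddSubgroup.mem_iInf]

/-- If `x` and `y` lie in one connected component of the fixed point set of `H`, and `y` is fixed
by the whole group, which acts diagonally on the tangent space at `y`, then `x` is fixed by every
element that acts trivially on the tangent space of that component at `y`, and the isotropy
representation of these elements at `x` is that at `y`. -/
theorem isotropyDiagonal_of_mem_connectedComponentIn [CompleteSpace E]
    [IsManifold 𝓘(ℝ, E) ∞ X] [T2Space X] [Finite G]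
    (hs : ∀ g : G, ContMDiff 𝓘(ℝ, E) 𝓘(ℝ, E) ∞ (fun y : X => g +ᵥ y)) {ι : Type*}
    (H : AddSubgroup G) (α : ι → G →+ ZMod 2) {x y : X}
    (hx : x ∈ AddAction.fixedPoints H X)
    (hy : y ∈ connectedComponentIn (AddAction.fixedPoints H X) x)
    (hfix : ∀ g : G, g +ᵥ y = y)
    (hα : IsotropyDiagonal (E := E) (signClosure H α) (fun i => α i) y) :
    (∀ g ∈ signClosure H α, g +ᵥ x = x) ∧
      IsotropyDiagonal (E := E) (signClosure H α) (fun i => α i) x := by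
  set K := signClosure H α with hK
  have hHK : H ≤ K := fun h hh => mem_signClosure.2 fun i hi => hi h hh
  -- The trace of `W` on the component is open and closed: `u` is a neighbourhood of `W` that meets
  -- the component only in `W`, and `v` is a neighbourhood of the complement of `W` that misses `W`.
  set W : Set X := {w | (∀ g ∈ K, g +ᵥ w = w) ∧ IsotropyDiagonal (E := E) K (fun i => α i) w}
    with hW
  set F : Set X := {w | ∀ g ∈ K, g +ᵥ w = w} with hF
  have hFc : IsClosed F := by
    have : F = ⋂ g ∈ K, {w : X | g +ᵥ w = w} := by ext; simp [hF]
    rw [this]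
    exact isClosed_biInter fun g _ => isClosed_eq (hs g).continuous continuous_id
  have : Nonempty (OpenPartialHomeomorph X E) := ⟨chartAt E x⟩
  choose! ψ hψx hψ hψC using exists_linearization_addSubgroup (E := E) hs K (X := X)
  set u : Set X := ⋃ w ∈ W, (ψ w).source
  set v : Set X := Fᶜ ∪ ⋃ w ∈ F \ W, (ψ w).source
  have hu : IsOpen u := isOpen_biUnion fun w _ => (ψ w).open_source
  have hv : IsOpen v := hFc.isOpen_compl.union (isOpen_biUnion fun w _ => (ψ w).open_source)
  set c := connectedComponentIn (AddAction.fixedPoints H X) x with hc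
  have hcH : ∀ z ∈ c, ∀ h ∈ H, h +ᵥ z = z := fun z hz h hh =>
    connectedComponentIn_subset _ _ hz ⟨h, hh⟩
  have huW : ∀ z ∈ c, z ∈ u → z ∈ W := by
    intro z hz hzu
    obtain ⟨w, hw, hzw⟩ := Set.mem_iUnion₂.1 hzu
    -- As `H` fixes `z`, its linear coordinates vanish wherever a weight is nontrivial on `H`; on
    -- the remaining ones `K` acts trivially, so `K` fixes `z`.
    have hzF : z ∈ F := by
      obtain ⟨B, hB⟩ := hw.2
      set e : ι → ℝ := B.symm (ψ w z) with he
      have hBe : B e = ψ w z := B.apply_symm_apply _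
      have he0 : ∀ i, (∃ h ∈ H, α i h ≠ 0) → e i = 0 := by
        rintro i ⟨h, hh, hne⟩
        have h1 := (hψ w hw.1 h (hHK hh) z hzw).2
        rw [hcH z hz h hh, ← hBe, hB h (hHK hh)] at h1
        have h2 := congrFun (B.injective h1) i
        simp only at h2
        rw [(eq_zero_or_eq_one_of_zmod_two _).resolve_left hne, sgn_one] at h2
        linarith
      intro g hg
      obtain ⟨h1, h2⟩ := hψ w hw.1 g hg z hzw
      refine (ψ w).injOn h1 hzw ?_
      rw [h2, ← hBe, hB g hg]
      congr 1
      funext i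
      change sgn (α i g) * e i = e i
      by_cases hi : ∀ h ∈ H, α i h = 0
      · rw [mem_signClosure.1 hg i hi, sgn_zero, one_mul]
      · push Not at hi
        rw [he0 i hi, mul_zero]
    obtain ⟨C, hC⟩ := hψC w hw.1 z hzw hzF
    exact ⟨hzF, hw.2.congr C hC⟩
  have hvW : ∀ z ∈ v, z ∉ W := by
    rintro z (hz | hz) hzW
    · exact hz hzW.1
    · obtain ⟨w, hw, hzw⟩ := Set.mem_iUnion₂.1 hz
      obtain ⟨C, hC⟩ := hψC w hw.1 z hzw hzW.1
      refine hw.2 ⟨hw.1, hzW.2.congr C.symm fun g hg a => ?_⟩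
      rw [C.eq_symm_apply, ← hC g hg, C.apply_symm_apply]
  have hcov : c ⊆ u ∪ v := by
    intro z _
    by_cases hzF : z ∈ F
    · by_cases hzW : z ∈ W
      · exact Or.inl (Set.mem_biUnion hzW (hψx z hzF))
      · exact Or.inr (Or.inr (Set.mem_biUnion (show z ∈ F \ W from ⟨hzF, hzW⟩) (hψx z hzF)))
    · exact Or.inr (Or.inl hzF)
  have hyW : y ∈ W := ⟨fun g _ => hfix g, hα⟩
  have hyu : y ∈ u := Set.mem_biUnion hyW (hψx y hyW.1)
  have hxc : x ∈ c := mem_connectedComponentIn hx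
  have hxW : x ∈ W := by
    refine huW x hxc ((hcov hxc).resolve_right fun hxv => ?_)
    obtain ⟨z, hz, hzu, hzv⟩ :=
      isPreconnected_connectedComponentIn u v hu hv hcov ⟨y, hy, hyu⟩ ⟨x, hxc, hxv⟩
    exact hvW z hzv (huW z hz hzu)
  exact hxW

end Propagation

/-! ### Charts on orbit spaces -/

section Quotient

/-- The image of an open surjection is locally homeomorphic to `F` if the source has an open cover
by sets with open continuous maps to `F` that have the same fibres as the surjection. -/
theorem nonempty_chartedSpace_of_isOpenMap {X Q F : Type*} [TopologicalSpace X]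
    [TopologicalSpace Q] [TopologicalSpace F] {π : X → Q} (hπ : Continuous π)
    (hπo : IsOpenMap π) (hπs : Function.Surjective π)
    (h : ∀ x, ∃ U : Set X, IsOpen U ∧ x ∈ U ∧ ∃ f : X → F, ContinuousOn f U ∧
      (∀ V ⊆ U, IsOpen V → IsOpen (f '' V)) ∧ ∀ a ∈ U, ∀ b ∈ U, f a = f b ↔ π a = π b) :
    Nonempty (ChartedSpace F Q) := by
  have key : ∀ x, ∃ e : OpenPartialHomeomorph Q F, π x ∈ e.source := by
    intro x
    have : Nonempty X := ⟨x⟩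
    obtain ⟨U, hU, hxU, f, hf, hfo, hfib⟩ := h x
    -- The chart is `f` after a choice of preimages under `π`. Equality of the fibres makes the
    -- choice harmless, and openness of `π` and `f` gives continuity both ways.
    set s : Q → X := Function.invFunOn π U
    set t : F → X := Function.invFunOn f U
    have hs : ∀ a ∈ U, s (π a) ∈ U ∧ π (s (π a)) = π a := fun a ha =>
      ⟨Function.invFunOn_mem ⟨a, ha, rfl⟩, Function.invFunOn_eq ⟨a, ha, rfl⟩⟩
    have ht : ∀ a ∈ U, t (f a) ∈ U ∧ f (t (f a)) = f a := fun a ha =>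
      ⟨Function.invFunOn_mem ⟨a, ha, rfl⟩, Function.invFunOn_eq ⟨a, ha, rfl⟩⟩
    have hfs : ∀ a ∈ U, f (s (π a)) = f a := fun a ha =>
      (hfib _ (hs a ha).1 a ha).2 (hs a ha).2
    have hπt : ∀ a ∈ U, π (t (f a)) = π a := fun a ha =>
      (hfib _ (ht a ha).1 a ha).1 (ht a ha).2
    have hsrc : IsOpen (π '' U) := hπo U hU
    have htgt : IsOpen (f '' U) := hfo U subset_rfl hU
    refine ⟨{
      toFun := fun q => f (s q)
      invFun := fun e => π (t e)
      source := π '' U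
      target := f '' U
      map_source' := ?_
      map_target' := ?_
      left_inv' := ?_
      right_inv' := ?_
      open_source := hsrc
      open_target := htgt
      continuousOn_toFun := ?_
      continuousOn_invFun := ?_ }, ⟨x, hxU, rfl⟩⟩
    · rintro _ ⟨a, ha, rfl⟩
      exact ⟨a, ha, (hfs a ha).symm⟩
    · rintro _ ⟨a, ha, rfl⟩
      exact ⟨a, ha, (hπt a ha).symm⟩
    · rintro _ ⟨a, ha, rfl⟩
      rw [hfs a ha, hπt a ha]
    · rintro _ ⟨a, ha, rfl⟩
      rw [hπt a ha, hfs a ha]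
    · refine (continuousOn_open_iff hsrc).2 fun V hV => ?_
      have : π '' U ∩ (fun q => f (s q)) ⁻¹' V = π '' (U ∩ f ⁻¹' V) := by
        ext q
        constructor
        · rintro ⟨⟨a, ha, rfl⟩, hq⟩
          refine ⟨a, ⟨ha, ?_⟩, rfl⟩
          rw [Set.mem_preimage, hfs a ha] at hq
          exact hq
        · rintro ⟨a, ⟨ha, hq⟩, rfl⟩
          refine ⟨⟨a, ha, rfl⟩, ?_⟩
          rw [Set.mem_preimage, hfs a ha]
          exact hq
      rw [this]
      exact hπo _ (hf.isOpen_inter_preimage hU hV)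
    · refine (continuousOn_open_iff htgt).2 fun V hV => ?_
      have : f '' U ∩ (fun e => π (t e)) ⁻¹' V = f '' (U ∩ π ⁻¹' V) := by
        ext q
        constructor
        · rintro ⟨⟨a, ha, rfl⟩, hq⟩
          refine ⟨a, ⟨ha, ?_⟩, rfl⟩
          rw [Set.mem_preimage, hπt a ha] at hq
          exact hq
        · rintro ⟨a, ⟨ha, hq⟩, rfl⟩
          refine ⟨⟨a, ha, rfl⟩, ?_⟩
          rw [Set.mem_preimage, hπt a ha]
          exact hq
      rw [this]
      exact hfo _ Set.inter_subset_left (hU.inter (hV.preimage hπ))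
  choose e he using key
  choose r hr using hπs
  exact ⟨{
    atlas := Set.range e
    chartAt := fun q => e (r q)
    mem_chart_source := fun q => by
      have := he (r q)
      rwa [hr] at this
    chart_mem_atlas := fun q => ⟨_, rfl⟩ }⟩

/-- A point of a Hausdorff space with an action of a finite group has an open neighbourhood that is
disjoint from its translates by the elements that move the point. -/
theorem exists_isOpen_forall_vadd_mem {G X : Type*} [AddGroup G] [Finite G] [TopologicalSpace X]
    [T2Space X] [AddAction G X] [ContinuousConstVAdd G X] (x : X) :
    ∃ N : Set X, IsOpen N ∧ x ∈ N ∧ ∀ g : G, ∀ a ∈ N, g +ᵥ a ∈ N → g +ᵥ x = x := by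
  have key : ∀ g : G, ∃ N : Set X, IsOpen N ∧ x ∈ N ∧ ∀ a ∈ N, g +ᵥ a ∈ N → g +ᵥ x = x := by
    intro g
    by_cases hg : g +ᵥ x = x
    · exact ⟨Set.univ, isOpen_univ, trivial, fun _ _ _ => hg⟩
    · obtain ⟨A, B, hA, hB, hxA, hxB, hAB⟩ := t2_separation hg
      refine ⟨B ∩ (fun y => g +ᵥ y) ⁻¹' A, hB.inter (hA.preimage (continuous_const_vadd g)),
        ⟨hxB, hxA⟩, fun a ha hga => ?_⟩
      exact absurd hga.1 (Set.disjoint_left.1 hAB ha.2)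
  choose N hN hxN hNg using key
  refine ⟨⋂ g, N g, isOpen_iInter_of_finite hN, Set.mem_iInter.2 hxN, fun g a ha hga => ?_⟩
  exact hNg g a (Set.mem_iInter.1 ha g) (Set.mem_iInter.1 hga g)

end Quotient

/-! ### Proof of the main theorem -/

theorem IsTangentWeights.isotropyDiagonal {n k : ℕ} {X : Type*} [TopologicalSpace X]
    [ChartedSpace (EuclideanSpace ℝ (Fin n)) X] [AddAction (TwoTorus k) X] {x : X}
    {α : Fin n → Module.Dual (ZMod 2) (TwoTorus k)} (h : IsTangentWeights x α)
    (K : AddSubgroup (TwoTorus k)) :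
    IsotropyDiagonal (E := EuclideanSpace ℝ (Fin n)) K (fun i => α i) x := by
  obtain ⟨b, hb⟩ := h
  -- Every tangent space is by definition the model space, so second components in the tangent
  -- bundle can be compared directly.
  let b' : Module.Basis (Fin n) ℝ (EuclideanSpace ℝ (Fin n)) := b
  have hb' : ∀ t i, isotropy (E := EuclideanSpace ℝ (Fin n)) t x (b' i) = sgn (α i t) • b' i :=
    fun t i => congrArg (fun p : TangentBundle (𝓡 n) X => (p.2 : EuclideanSpace ℝ (Fin n))) (hb t i)
  refine ⟨b'.equivFun.symm.toContinuousLinearEquiv, fun t _ v => ?_⟩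
  simp only [LinearEquiv.coe_toContinuousLinearEquiv', Module.Basis.equivFun_symm_apply, map_sum,
    map_smul, hb']
  exact Finset.sum_congr rfl fun i _ => by rw [smul_smul, mul_comm]

theorem mainTheorem2 (n : ℕ) (hn : 1 ≤ n) (X : Type*) [TopologicalSpace X]
    [T2Space X] [CompactSpace X] [ConnectedSpace X]
    [ChartedSpace (EuclideanSpace ℝ (Fin n)) X] [IsManifold (𝓡 n) ∞ X]
    [AddAction (TwoTorus (n - 1)) X]
    (hsmooth : ∀ t : TwoTorus (n - 1), ContMDiff (𝓡 n) (𝓡 n) ∞ (fun y : X => t +ᵥ y))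
    (hgen : InGeneralPosition n (n - 1) X)
    (hfix : ComponentsHaveFixedPoints (n - 1) X) :
    IsTopologicalManifold n (AddAction.orbitRel.Quotient (TwoTorus (n - 1)) X) := by
  classical
  have : ContinuousConstVAdd (TwoTorus (n - 1)) X := ⟨fun t => (hsmooth t).continuous⟩
  have : LocallyCompactSpace X := ChartedSpace.locallyCompactSpace (EuclideanSpace ℝ (Fin n)) X
  have : SecondCountableTopology X :=
    ChartedSpace.secondCountable_of_sigmaCompact (EuclideanSpace ℝ (Fin n)) X
  refine ⟨t2Space_of_properlyDiscontinuousVAdd_of_t2Space,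
    ContinuousConstVAdd.secondCountableTopology, ?_⟩
  refine nonempty_chartedSpace_of_isOpenMap (π := Quotient.mk _) continuous_quot_mk
    isOpenMap_quotient_mk'_add Quotient.mk_surjective fun x => ?_
  set H := AddAction.stabilizer (TwoTorus (n - 1)) x with hH
  have hx : x ∈ AddAction.fixedPoints H X := fun h => h.2
  obtain ⟨y, hy, hyfix⟩ := hfix H x hx
  obtain ⟨α, hw, hα⟩ := hgen y hyfix
  set β : Fin n → TwoTorus (n - 1) →+ ZMod 2 := fun i => (α i).toAddMonoidHom with hβ
  obtain ⟨hK, B, hB⟩ := isotropyDiagonal_of_mem_connectedComponentIn hsmooth H β hx hy hyfix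
    (hw.isotropyDiagonal (signClosure H β))
  obtain ⟨ψ, hxψ, hψ, -⟩ := exists_linearization_addSubgroup hsmooth (signClosure H β) x hK
  -- The folded coordinates are those on which `H` acts nontrivially.
  obtain ⟨f, hfc, hfo, hf⟩ := exists_fold (Finset.univ.filter fun i => ∃ h ∈ H, α i h ≠ 0)
  obtain ⟨N, hN, hxN, hNg⟩ := exists_isOpen_forall_vadd_mem (G := TwoTorus (n - 1)) x
  have hψB : ∀ g ∈ signClosure H β, ∀ z ∈ ψ.source,
      B.symm (ψ (g +ᵥ z)) = fun i => sgn (α i g) * B.symm (ψ z) i := by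
    intro g hg z hz
    rw [B.symm_apply_eq, (hψ g hg z hz).2]
    have := hB g hg (B.symm (ψ z))
    rwa [B.apply_symm_apply] at this
  let T := (EuclideanSpace.equiv (Fin n) ℝ).symm.toHomeomorph
  refine ⟨ψ.source ∩ N, ψ.open_source.inter hN, ⟨hxψ, hxN⟩, fun z => T (f (B.symm (ψ z))),
    ?_, ?_, ?_⟩
  · exact (T.continuous.comp (hfc.comp B.symm.continuous)).comp_continuousOn
      (ψ.continuousOn.mono Set.inter_subset_left)
  · intro V hV hVo
    have h1 : IsOpen (ψ '' V) :=
      ψ.isOpen_image_of_subset_source hVo (hV.trans Set.inter_subset_left)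
    have h2 := T.isOpenMap _ (hfo _ (B.symm.toHomeomorph.isOpenMap _ h1))
    simp only [Set.image_image] at h2
    exact h2
  · intro a ha b hb
    rw [T.injective.eq_iff, hf]
    constructor
    -- Points with the same fold differ by an even `ε` supported on the folded coordinates. Some `t`
    -- realizes `ε`, and it lies in `signClosure H β` because `ε` vanishes on the other coordinates.
    · rintro ⟨ε, hε0, hεs, hε⟩
      obtain ⟨t, ht⟩ := exists_weights_apply_eq hn hα ε hεs
      have htK : t ∈ signClosure H β := by
        refine mem_signClosure.2 fun i hi => ?_
        change α i t = 0
        rw [ht]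
        refine hε0 i fun hmem => ?_
        obtain ⟨h, hh, hne⟩ := (Finset.mem_filter.1 hmem).2
        exact hne (hi h hh)
      have hab : b = t +ᵥ a := by
        refine ψ.injOn hb.1 (hψ t htK a ha.1).1 (B.symm.injective ?_)
        rw [hψB t htK a ha.1]
        funext i
        rw [hε, ht]
      exact (Quotient.sound (AddAction.orbitRel_apply.2 ⟨t, hab.symm⟩)).symm
    · intro hab
      obtain ⟨t, ht⟩ := AddAction.orbitRel_apply.1 (Quotient.exact hab.symm)
      have ht' : t +ᵥ a = b := ht
      -- By the choice of `N`, an element that joins two points of the neighbourhood stabilizes `x`,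
      -- so it acts by an even change of sign.
      have htx : t +ᵥ x = x := hNg t a ha.2 (ht' ▸ hb.2)
      have htH : t ∈ H := htx
      have htK : t ∈ signClosure H β := mem_signClosure.2 fun i hi => hi t htH
      refine ⟨fun i => α i t, fun i hi => ?_, ?_, fun i => ?_⟩
      · by_contra hne
        exact hi (Finset.mem_filter.2 ⟨Finset.mem_univ i, t, htH, hne⟩)
      · rw [← LinearMap.sum_apply, sum_weights_eq_zero hn hα, LinearMap.zero_apply]
      · rw [← ht', hψB t htK a ha.1]
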